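/- Subdivision Theorem. Let $n\ge 0$ and let $R$ be a commutative ring with unit. The $n$-simplex category $\mathrm{Cat}[n]$ has as objects the abstract simplex $\langle 0,1,\dots,n\rangle$ and all its faces (the non-empty subsets of $\{0,\dots,n\}$), and it has exactly one morphism $\sigma\to\tau$ if $\tau\subseteq\sigma$ and none otherwise. Let $F:\mathrm{Cat}[n]\to R\text{-}\mathrm{Mod}$ be a (covariant) functor. A pre-simplicial module is a sequence of $R$-modules $X_0,X_1,\dots$ with face operators $d_i:X_{k}\to X_{k-1}$ ($k\ge 1$, $0\le i\le k$) such that $d_id_j=d_{j-1}d_i$ for $i<j$; its homology is that of the chain complex with boundary $\sum_i(-1)^id_i$. Consider the following objects. (a) $F(\nabla[n])$ is the pre-simplicial module with $$F(\nabla[n])_k=\bigoplus_{0\le a_0<\dots<a_k\le n}F(\{a_0,\dots,a_k\}),$$ where $d_i$ maps the summand of $\langle a_0,\dots,a_k\rangle$ to that of $\langle a_0,\dots,\widehat{a_i},\dots,a_k\rangle$ by the value of $F$ on the face morphism. (b) $F(\mathrm{Subdiv}(\nabla[n]))$ is the pre-simplicial module with $$F(\mathrm{Subdiv}(\nabla[n]))_k=\bigoplus_{\sigma_0\supsetneq\sigma_1\supsetneq\dots\supsetneq\sigma_k}F(\sigma_0),$$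 the sum being over the $k$-simplices of the barycentric subdivision of the $n$-simplex, that is, over the flags of faces. Here $d_i$ deletes $\sigma_i$; it acts on coefficients by the identity if $i>0$ and by $F(\sigma_0\to\sigma_1)$ if $i=0$. (c) For a small category $C$ and a functor $F:C\to R\text{-}\mathrm{Mod}$, $F(\mathrm{Nerve}\,C)$ is the simplicial module with $$F(\mathrm{Nerve}\,C)_k=\bigoplus_{A_0\xrightarrow{f_0}A_1\to\dots\to A_k}F(A_0),$$ the sum being over the $k$-simplices of the nerve of $C$. The faces and degeneracies are those of the nerve on the index strings and the identity on coefficients, except that $d_0$ acts on coefficients by $F(f_0)$. The homology $H_*(C,F)$ of $C$ with coefficients in $F$ is the homology of $F(\mathrm{Nerve}\,C)$, with boundary $\sum_i(-1)^id_i$. Then, as $R$-modules and in every degree $k\ge 0$, $$H_k(\mathrm{Cat}[n],F)\cong H_k(F(\mathrm{Subdiv}(\nabla[n])))\qquad\text{and}\qquad H_k(F(\mathrm{Subdiv}(\nabla[n])))\cong H_k(F(\nabla[n])).$$ Hence $$H_k(\mathrm{Cat}[n],F)\cong H_k(F(\mathrm{Nerve}\,\mathrm{Cat}[n]))\cong H_k(F(\nabla[n])).$$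 -/

import Mathlib

open CategoryTheory CategoryTheory.Limits Opposite

universe w w' v u

noncomputable section

/-- A pre-simplicial object: objects `X₀, X₁, …` and face operators `dᵢ : Xₖ₊₁ ⟶ Xₖ`
for `0 ≤ i ≤ k + 1` subject to the face identities `dᵢ dⱼ₊₁ = dⱼ dᵢ` for `i ≤ j`
(written here in diagrammatic order). No degeneracies are given. -/
structure PreSimplicialObject (A : Type u) [Category.{v} A] where
  /-- the object of `k`-simplices -/
  obj : ℕ → A
  /-- the face operators -/
  d : ∀ {k : ℕ}, Fin (k + 2) → (obj (k + 1) ⟶ obj k)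
  d_comp_d : ∀ {k : ℕ} {i j : Fin (k + 2)}, i ≤ j →
    d j.succ ≫ d i = d i.castSucc ≫ d j

namespace PreSimplicialObject

section Complex

variable {A : Type u} [Category.{v} A] [Preadditive A] (X : PreSimplicialObject A)

/-- The boundary operator `∂ = ∑ᵢ (-1)ⁱ dᵢ`. -/
def boundary (k : ℕ) : X.obj (k + 1) ⟶ X.obj k :=
  ∑ i : Fin (k + 2), (-1 : ℤ) ^ (i : ℕ) • X.d i

theorem boundary_comp_boundary (k : ℕ) : X.boundary (k + 1) ≫ X.boundary k = 0 := by
  dsimp only [boundary]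
  simp only [Preadditive.comp_sum, Preadditive.sum_comp, ← Finset.sum_product']
  let P := Fin (k + 2) × Fin (k + 3)
  let S : Finset P := {ij : P | (ij.2 : ℕ) ≤ (ij.1 : ℕ)}
  rw [Finset.univ_product_univ, ← Finset.sum_add_sum_compl S, ← eq_neg_iff_add_eq_zero,
    ← Finset.sum_neg_distrib]
  let φ : ∀ ij : P, ij ∈ S → P := fun ij hij =>
    (Fin.castLT ij.2 (lt_of_le_of_lt (Finset.mem_filter.mp hij).right (Fin.is_lt ij.1)), ij.1.succ)
  apply Finset.sum_bij φ
  · intro ij hij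
    simp_rw [S, φ, Finset.compl_filter, Finset.mem_filter_univ, Fin.val_succ,
      Fin.val_castLT] at hij ⊢
    lia
  · rintro ⟨i, j⟩ hij ⟨i', j'⟩ hij' h
    rw [Prod.mk_inj]
    exact ⟨by simpa [φ] using! congr_arg Prod.snd h,
      by simpa [φ, Fin.castSucc_castLT] using! congr_arg Fin.castSucc (congr_arg Prod.fst h)⟩
  · rintro ⟨i', j'⟩ hij'
    simp_rw [S, Finset.compl_filter, Finset.mem_filter_univ, not_le] at hij'
    refine ⟨(j'.pred <| ?_, Fin.castSucc i'), ?_, ?_⟩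
    · rintro rfl
      simp only [Fin.val_zero, not_lt_zero] at hij'
    · simpa [S] using! Nat.le_sub_one_of_lt hij'
    · simp only [φ, Fin.castLT_castSucc, Fin.succ_pred]
  · rintro ⟨i, j⟩ hij
    have hle : (j : ℕ) ≤ (i : ℕ) := by simpa [S] using! hij
    have hj : (j : ℕ) < k + 2 := lt_of_le_of_lt hle i.is_lt
    have key := X.d_comp_d (i := j.castLT hj) (j := i) (Fin.le_iff_val_le_val.mpr hle)
    rw [Fin.castSucc_castLT] at key
    dsimp
    simp only [Preadditive.zsmul_comp, Preadditive.comp_zsmul, smul_smul, ← neg_smul]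
    congr 1
    · simp only [φ, Fin.val_succ, pow_add, pow_one, mul_neg, neg_neg, mul_one]
      apply mul_comm
    · exact key.symm

/-- The chain complex of a pre-simplicial object, with boundary `∑ᵢ (-1)ⁱ dᵢ`. -/
def chainComplex : ChainComplex A ℕ :=
  ChainComplex.of X.obj X.boundary X.boundary_comp_boundary

/-- The homology of a pre-simplicial object. -/
def homology [CategoryWithHomology A] (k : ℕ) : A :=
  X.chainComplex.homology k

end Complex

section Coefficients

variable {C : Type w'} [Preorder C] {A : Type u} [Category.{v} A] [HasCoproducts.{w} A]

theorem map_ι_eq {J : Type w} (ℓ : J → C) (F : C ⥤ A) {c : C} {x y : J}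
    (hx : c ≤ ℓ x) (hy : c ≤ ℓ y) (h : x = y) :
    F.map (homOfLE hx) ≫ Sigma.ι (fun z => F.obj (ℓ z)) x =
      F.map (homOfLE hy) ≫ Sigma.ι (fun z => F.obj (ℓ z)) y := by
  subst h; rfl

/-- The pre-simplicial object `F(X)` induced on a pre-simplicial set `X` by a functor `F`.
Each simplex `x` of `X` carries an object `ℓ x` of the category `C` given by a preorder, such
that there is a (unique) arrow `ℓ x ⟶ ℓ (dᵢ x)` for each face. The `k`-simplices of `F(X)` are
`⨁_{x ∈ Xₖ} F(ℓ x)`; the operator `dᵢ` maps the summand of `x` to the summand of `dᵢ x` by the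
value of `F` on `ℓ x ⟶ ℓ (dᵢ x)`. -/
def withCoefficients (X : PreSimplicialObject (Type w)) (ℓ : ∀ k, X.obj k → C)
    (hℓ : ∀ {k : ℕ} (i : Fin (k + 2)) (x : X.obj (k + 1)), ℓ (k + 1) x ≤ ℓ k (X.d i x))
    (F : C ⥤ A) : PreSimplicialObject A where
  obj k := ∐ fun x : X.obj k => F.obj (ℓ k x)
  d {k} i := Sigma.desc fun x =>
    F.map (homOfLE (hℓ i x)) ≫ Sigma.ι (fun y : X.obj k => F.obj (ℓ k y)) (X.d i x)
  d_comp_d {k i j} hij := by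
    apply Sigma.hom_ext
    intro x
    have hx : X.d i (X.d j.succ x) = X.d j (X.d i.castSucc x) :=
      ConcreteCategory.congr_hom (X.d_comp_d hij) x
    simp only [colimit.ι_desc_assoc, Cofan.mk_ι_app, Discrete.functor_obj_eq_as,
      Category.assoc, colimit.ι_desc, ← Functor.map_comp_assoc, homOfLE_comp]
    exact map_ι_eq (ℓ k) F _ _ hx

end Coefficients

/-- The pre-simplicial set of strict chains `x₀ < x₁ < ⋯ < xₖ` in a partially ordered set, where
`dᵢ` deletes the entry `xᵢ`. -/
def strictChains (P : Type w) [PartialOrder P] : PreSimplicialObject (Type w) where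
  obj k := Fin (k + 1) ↪o P
  d i := ↾fun x => (Fin.succAboveOrderEmb i).trans x
  d_comp_d {k i j} hij := by
    ext x a
    have h := congr_arg (fun f => SimplexCategory.Hom.toOrderHom f a)
      (SimplexCategory.δ_comp_δ hij)
    exact congr_arg x h

end PreSimplicialObject

/-- The `n`-simplex category `Cat[n]`: its objects are the abstract simplex `⟨0, 1, …, n⟩` and all
its faces, that is, the non-empty subsets of `{0, …, n}`; there is exactly one arrow `σ ⟶ τ` when
`τ` is a face of `σ` (the composite of the face maps deleting the vertices not in `τ`, in any
order), and none otherwise. This is the category of the reverse inclusion order. -/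
abbrev SimplexCat (n : ℕ) : Type :=
  {σ : Finset (Fin (n + 1)) // σ.Nonempty}ᵒᵈ

namespace SimplexCat

/-- The pre-simplicial set `∇[n]` generated by an abstract `n`-simplex: the `k`-simplices are
`⟨a₀, …, aₖ⟩` with `a₀ < ⋯ < aₖ` in `{0, …, n}`, and `dᵢ` deletes `aᵢ`. -/
abbrev nabla (n : ℕ) : PreSimplicialObject Type :=
  PreSimplicialObject.strictChains (Fin (n + 1))

/-- The pre-simplicial set `Subdiv(∇[n])` of the barycentric subdivision of the abstract
`n`-simplex: the vertices are its faces, the `k`-simplices are the flags `σ₀ ⊋ σ₁ ⊋ ⋯ ⊋ σₖ`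
of faces, and `dᵢ` deletes `σᵢ`. -/
abbrev subdiv (n : ℕ) : PreSimplicialObject Type :=
  PreSimplicialObject.strictChains (SimplexCat n)

/-- The face `{a₀, …, aₖ}` of the `n`-simplex, as an object of `Cat[n]`. -/
def nablaFace (n k : ℕ) (a : (nabla n).obj k) : SimplexCat n :=
  OrderDual.toDual ⟨Finset.univ.map (RelEmbedding.toEmbedding a), Finset.univ_nonempty.map⟩

theorem nablaFace_le (n : ℕ) {k : ℕ} (i : Fin (k + 2)) (a : (nabla n).obj (k + 1)) :
    nablaFace n (k + 1) a ≤ nablaFace n k ((nabla n).d i a) := by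
  change Finset.univ.map (RelEmbedding.toEmbedding ((Fin.succAboveOrderEmb i).trans a)) ⊆
    Finset.univ.map (RelEmbedding.toEmbedding a)
  intro y hy
  simp only [Finset.mem_map, Finset.mem_univ, true_and] at hy ⊢
  obtain ⟨t, rfl⟩ := hy
  exact ⟨i.succAbove t, rfl⟩

/-- The leading face `σ₀` of a flag `σ₀ ⊋ ⋯ ⊋ σₖ`. -/
def subdivFace (n k : ℕ) (s : (subdiv n).obj k) : SimplexCat n :=
  (show Fin (k + 1) ↪o SimplexCat n from s) 0

theorem subdivFace_le (n : ℕ) {k : ℕ} (i : Fin (k + 2)) (s : (subdiv n).obj (k + 1)) :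
    subdivFace n (k + 1) s ≤ subdivFace n k ((subdiv n).d i s) :=
  (show Fin (k + 2) ↪o SimplexCat n from s).monotone (Fin.zero_le (i.succAbove 0))

variable {A : Type u} [Category.{v} A] [HasCoproducts.{0} A] {n : ℕ}

/-- The pre-simplicial object `F(∇[n])`: in degree `k` it is `⨁ F({a₀, …, aₖ})` over
`a₀ < ⋯ < aₖ`. -/
def nablaCoeff (F : SimplexCat n ⥤ A) : PreSimplicialObject A :=
  (nabla n).withCoefficients (nablaFace n) (nablaFace_le n) F

/-- The pre-simplicial object `F(Subdiv(∇[n]))`: in degree `k` it is `⨁ F(σ₀)` over the flags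
`σ₀ ⊋ ⋯ ⊋ σₖ`. -/
def subdivCoeff (F : SimplexCat n ⥤ A) : PreSimplicialObject A :=
  (subdiv n).withCoefficients (subdivFace n) (subdivFace_le n) F

end SimplexCat

section CategoryHomology

variable {C : Type w} [Category.{w'} C] {A : Type u} [Category.{v} A]
  [HasCoproducts.{max w w'} A]

/-- The string `A_{f(0)} ⟶ ⋯ ⟶ A_{f(m)}` obtained from `A₀ ⟶ ⋯ ⟶ Aₖ` by a monotone map `f`; this is
the simplicial structure of the nerve. -/
abbrev nerveReindex {m k : ℕ} (x : ComposableArrows C k) (f : Fin (m + 1) →o Fin (k + 1)) :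
    ComposableArrows C m :=
  x.whiskerLeft f.monotone.functor

/-- The morphism `A₀ ⟶ A_{f(0)}` of the string `A₀ ⟶ ⋯ ⟶ Aₖ`. -/
def nerveLeadingMap {m k : ℕ} (x : ComposableArrows C k) (f : Fin (m + 1) →o Fin (k + 1)) :
    x.obj 0 ⟶ (nerveReindex x f).obj 0 :=
  x.map (homOfLE (Fin.zero_le (f 0)))

theorem nerveLeadingMap_id {k : ℕ} (x : ComposableArrows C k) :
    nerveLeadingMap x OrderHom.id = 𝟙 (x.obj 0) :=
  x.map_id 0

theorem nerveLeadingMap_comp {l m k : ℕ} (x : ComposableArrows C k) (f : Fin (m + 1) →o Fin (k + 1))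
    (g : Fin (l + 1) →o Fin (m + 1)) :
    nerveLeadingMap x (f.comp g) = nerveLeadingMap x f ≫ nerveLeadingMap (nerveReindex x f) g :=
  x.map_comp (homOfLE (Fin.zero_le (f 0))) (f.monotone.functor.map (homOfLE (Fin.zero_le (g 0))))

/-- The map `⨁_{A₀ ⟶ ⋯ ⟶ Aₖ} F(A₀) ⟶ ⨁_{B₀ ⟶ ⋯ ⟶ Bₘ} F(B₀)` induced by a monotone map `f`: it maps
the summand of `x` to the summand of `nerveReindex x f` by `F(A₀ ⟶ A_{f(0)})`. -/
def nerveCoeffMap (F : C ⥤ A) {m k : ℕ} (f : Fin (m + 1) →o Fin (k + 1)) :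
    (∐ fun x : ComposableArrows C k => F.obj (x.obj 0)) ⟶
      ∐ fun y : ComposableArrows C m => F.obj (y.obj 0) :=
  Sigma.desc fun x => F.map (nerveLeadingMap x f) ≫
    Sigma.ι (fun y : ComposableArrows C m => F.obj (y.obj 0)) (nerveReindex x f)

theorem nerveCoeffMap_id (F : C ⥤ A) {k : ℕ} :
    nerveCoeffMap F (OrderHom.id : Fin (k + 1) →o Fin (k + 1)) = 𝟙 _ := by
  apply Sigma.hom_ext
  intro x
  rw [nerveCoeffMap, colimit.ι_desc, Category.comp_id]
  exact (congr_arg (fun g => F.map g ≫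
    Sigma.ι (fun y : ComposableArrows C k => F.obj (y.obj 0)) x) (nerveLeadingMap_id x)).trans (by simp)

theorem nerveCoeffMap_comp (F : C ⥤ A) {l m k : ℕ} (f : Fin (m + 1) →o Fin (k + 1))
    (g : Fin (l + 1) →o Fin (m + 1)) :
    nerveCoeffMap F (f.comp g) = nerveCoeffMap F f ≫ nerveCoeffMap F g := by
  apply Sigma.hom_ext
  intro x
  simp only [nerveCoeffMap, colimit.ι_desc, colimit.ι_desc_assoc, Cofan.mk_ι_app, Category.assoc,
    nerveLeadingMap_comp]
  exact F.map_comp_assoc _ _ _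

/-- The simplicial object `F(Nerve C)`: in degree `k` it is `⨁ F(A₀)` over the `k`-simplices
`A₀ ⟶ A₁ ⟶ ⋯ ⟶ Aₖ` of the nerve of `C`. Writing `⟨λ; f₀, …, fₖ₋₁⟩` for `λ ∈ F(A₀)` in the summand
of such a string, one has `d₀⟨λ; f₀, …⟩ = ⟨F(f₀)(λ); f₁, …⟩`, while the other face operators and
the degeneracies keep `λ` and act on the string as in the nerve. -/
def nerveCoeff (F : C ⥤ A) : SimplicialObject A where
  obj Δ := ∐ fun x : ComposableArrows C Δ.unop.len => F.obj (x.obj 0)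
  map φ := nerveCoeffMap F φ.unop.toOrderHom
  map_id _ := nerveCoeffMap_id F
  map_comp φ ψ := nerveCoeffMap_comp F φ.unop.toOrderHom ψ.unop.toOrderHom

variable [Preadditive A] [CategoryWithHomology A]

/-- The homology of a simplicial object, computed by the complex with boundary
`∑ᵢ (-1)ⁱ dᵢ`. -/
def simplicialHomology (X : SimplicialObject A) (k : ℕ) : A :=
  ((AlgebraicTopology.alternatingFaceMapComplex A).obj X).homology k

/-- The homology `H_k(C, F)` of a small category `C` with coefficients in a functor `F`: the
homology of the complex with `⨁_{A₀ ⟶ ⋯ ⟶ Aₖ} F(A₀)` in degree `k`. -/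
def categoryHomology (F : C ⥤ A) (k : ℕ) : A :=
  simplicialHomology (nerveCoeff F) k

end CategoryHomology

end

noncomputable section

/-! All three complexes come from the method of acyclic carriers. Let `X` be a pre-simplicial set
whose simplices carry labels `ℓ x` in a preorder, with labels growing along faces. For each `p` the
simplices with `p ≤ ℓ x` form a pre-simplicial subset, and `p ↦ chainsAbove ℓ p` is the
contravariant functor `⨁ ℤ Hom(-, ℓ x)`, hence projective. If all these subsets have the homology of
a point, the integral chains form a projective resolution of the constant functor `ℤ`. The complex
with coefficients is this resolution tensored with `F`, so up to homotopy it does not depend on `X`.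

Concretely, `carriedMap` and `carriedHomotopy` build label-respecting chain maps and homotopies by
recursion on the degree, and `coeffMap` transports them to coefficients in `F`; the result is
`homotopyEquivOfIsAcyclic`. Acyclicity is a cone construction each time. Above `p` lie the strings
of objects under `p` for the nerve (cone from `p`), the flags of faces of `p` for the subdivision
(cone from `p`), and the faces of the simplex `p` for `∇[n]` (cone from its least vertex). -/

namespace PreSimplicialObject

/-! ### Label-respecting maps of integral chains and their action on coefficients -/

section FilteredMaps

variable {C : Type w'} [Preorder C] {J K L : Type w} {ℓJ : J → C} {ℓK : K → C} {ℓL : L → C}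

/-- The integral chains supported on the labels above `p`. -/
def chainsAbove (ℓ : J → C) (p : C) : Submodule ℤ (J →₀ ℤ) :=
  Finsupp.supported ℤ ℤ {x | p ≤ ℓ x}

theorem single_mem_chainsAbove {ℓ : J → C} {p : C} {x : J} (h : p ≤ ℓ x) (c : ℤ) :
    Finsupp.single x c ∈ chainsAbove ℓ p :=
  Finsupp.single_mem_supported ℤ c h

theorem chainsAbove_le_iff {ℓ : J → C} {p : C} {S : Submodule ℤ (J →₀ ℤ)} :
    chainsAbove ℓ p ≤ S ↔ ∀ x, p ≤ ℓ x → Finsupp.single x 1 ∈ S := by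
  rw [chainsAbove, Finsupp.supported_eq_span_single, Submodule.span_le, Set.image_subset_iff]
  rfl

theorem chainsAbove_anti (ℓ : J → C) {p q : C} (h : p ≤ q) : chainsAbove ℓ q ≤ chainsAbove ℓ p :=
  Finsupp.supported_mono fun _ hx => le_trans h hx

theorem eqOn_chainsAbove {G : Type*} [AddCommGroup G] {ℓ : J → C} {p : C}
    {φ ψ : (J →₀ ℤ) →ₗ[ℤ] G}
    (h : ∀ x, p ≤ ℓ x → φ (Finsupp.single x 1) = ψ (Finsupp.single x 1))
    {z : J →₀ ℤ} (hz : z ∈ chainsAbove ℓ p) : φ z = ψ z :=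
  (chainsAbove_le_iff (S := LinearMap.eqLocus φ ψ)).mpr h hz

/-- A linear map of integral chains is filtered if no summand of the image of a basis element has a
label that fails to be above the label of that element. -/
def IsFiltered (ℓJ : J → C) (ℓK : K → C) (f : (J →₀ ℤ) →ₗ[ℤ] (K →₀ ℤ)) : Prop :=
  ∀ x, f (Finsupp.single x 1) ∈ chainsAbove ℓK (ℓJ x)

theorem IsFiltered.map_mem {f : (J →₀ ℤ) →ₗ[ℤ] (K →₀ ℤ)} (hf : IsFiltered ℓJ ℓK f) {p : C}
    {z : J →₀ ℤ} (hz : z ∈ chainsAbove ℓJ p) : f z ∈ chainsAbove ℓK p :=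
  (chainsAbove_le_iff (S := (chainsAbove ℓK p).comap f)).mpr
    (fun x hx => chainsAbove_anti ℓK hx (hf x)) hz

theorem IsFiltered.comp {g : (K →₀ ℤ) →ₗ[ℤ] (L →₀ ℤ)} {f : (J →₀ ℤ) →ₗ[ℤ] (K →₀ ℤ)}
    (hg : IsFiltered ℓK ℓL g) (hf : IsFiltered ℓJ ℓK f) : IsFiltered ℓJ ℓL (g ∘ₗ f) :=
  fun x => hg.map_mem (hf x)

theorem IsFiltered.id (ℓ : J → C) : IsFiltered ℓ ℓ LinearMap.id :=
  fun _ => single_mem_chainsAbove le_rfl 1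

variable {A : Type u} [Category.{v} A] [Preadditive A] [HasCoproducts.{w} A] (F : C ⥤ A)

/-- The morphism from `F(p)` into the coproduct `⨁ F(ℓ x)` given by an integral chain; summands with
label not above `p` are dropped. -/
def chainInclusion (ℓ : J → C) (p : C) :
    (J →₀ ℤ) →ₗ[ℤ] (F.obj p ⟶ ∐ fun x : J => F.obj (ℓ x)) :=
  open Classical in
  Finsupp.linearCombination ℤ fun x =>
    if h : p ≤ ℓ x then F.map (homOfLE h) ≫ Sigma.ι (fun y : J => F.obj (ℓ y)) x else 0

theorem chainInclusion_single {ℓ : J → C} {p : C} {x : J} (h : p ≤ ℓ x) :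
    chainInclusion F ℓ p (Finsupp.single x 1) =
      F.map (homOfLE h) ≫ Sigma.ι (fun y : J => F.obj (ℓ y)) x := by
  simp [chainInclusion, h]

/-- Functoriality of `F` on each summand. The support condition is needed because a label above `p`
but not above `q` would be dropped on the left only. -/
theorem map_comp_chainInclusion {ℓ : J → C} {p q : C} (h : p ≤ q) {z : J →₀ ℤ}
    (hz : z ∈ chainsAbove ℓ q) :
    F.map (homOfLE h) ≫ chainInclusion F ℓ q z = chainInclusion F ℓ p z := by
  refine eqOn_chainsAbove (φ := (Preadditive.leftComp _ (F.map (homOfLE h))).toIntLinearMap ∘ₗ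
    chainInclusion F ℓ q) (fun x hx => ?_) hz
  rw [LinearMap.comp_apply, chainInclusion_single F hx, chainInclusion_single F (h.trans hx)]
  exact (F.map_comp_assoc (homOfLE h) (homOfLE hx) _).symm

/-- The morphism `⨁ F(ℓ x) ⟶ ⨁ F(ℓ y)` given by a filtered map of integral chains. -/
def coeffMap (ℓJ : J → C) (ℓK : K → C) (f : (J →₀ ℤ) →ₗ[ℤ] (K →₀ ℤ)) :
    (∐ fun x : J => F.obj (ℓJ x)) ⟶ ∐ fun y : K => F.obj (ℓK y) :=
  Sigma.desc fun x => chainInclusion F ℓK (ℓJ x) (f (Finsupp.single x 1))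

theorem ι_coeffMap (f : (J →₀ ℤ) →ₗ[ℤ] (K →₀ ℤ)) (x : J) :
    Sigma.ι (fun y : J => F.obj (ℓJ y)) x ≫ coeffMap F ℓJ ℓK f =
      chainInclusion F ℓK (ℓJ x) (f (Finsupp.single x 1)) := by
  simp [coeffMap]

theorem chainInclusion_comp_coeffMap {f : (J →₀ ℤ) →ₗ[ℤ] (K →₀ ℤ)} (hf : IsFiltered ℓJ ℓK f)
    {p : C} {z : J →₀ ℤ} (hz : z ∈ chainsAbove ℓJ p) :
    chainInclusion F ℓJ p z ≫ coeffMap F ℓJ ℓK f = chainInclusion F ℓK p (f z) := by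
  refine eqOn_chainsAbove (φ := (Preadditive.rightComp _ (coeffMap F ℓJ ℓK f)).toIntLinearMap ∘ₗ
    chainInclusion F ℓJ p) (ψ := chainInclusion F ℓK p ∘ₗ f) (fun x hx => ?_) hz
  rw [LinearMap.comp_apply, LinearMap.comp_apply, chainInclusion_single F hx]
  refine (Category.assoc _ _ _).trans ?_
  rw [ι_coeffMap]
  exact map_comp_chainInclusion F hx (hf x)

/-- Filteredness ensures that `coeffMap` drops no summand at the intermediate stage. This carries
chain-level identities over to coefficients in `F`. -/
theorem coeffMap_comp {f : (J →₀ ℤ) →ₗ[ℤ] (K →₀ ℤ)} {g : (K →₀ ℤ) →ₗ[ℤ] (L →₀ ℤ)}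
    (hf : IsFiltered ℓJ ℓK f) (hg : IsFiltered ℓK ℓL g) :
    coeffMap F ℓJ ℓL (g ∘ₗ f) = coeffMap F ℓJ ℓK f ≫ coeffMap F ℓK ℓL g := by
  apply Sigma.hom_ext
  intro x
  rw [ι_coeffMap, ← Category.assoc, ι_coeffMap, chainInclusion_comp_coeffMap F hg (hf x)]
  rfl

theorem coeffMap_id (ℓ : J → C) : coeffMap F ℓ ℓ LinearMap.id = 𝟙 _ := by
  apply Sigma.hom_ext
  intro x
  rw [ι_coeffMap, LinearMap.id_apply, chainInclusion_single F le_rfl,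
    Subsingleton.elim (homOfLE (le_refl (ℓ x))) (𝟙 (ℓ x)), F.map_id, Category.id_comp,
    Category.comp_id]

theorem coeffMap_add (f g : (J →₀ ℤ) →ₗ[ℤ] (K →₀ ℤ)) :
    coeffMap F ℓJ ℓK (f + g) = coeffMap F ℓJ ℓK f + coeffMap F ℓJ ℓK g := by
  apply Sigma.hom_ext
  intro x
  simp only [ι_coeffMap, Preadditive.comp_add, LinearMap.add_apply, map_add]

end FilteredMaps

/-! ### Acyclic carriers: existence and uniqueness up to homotopy -/

section Acyclic

/-- The boundary of the integral chains of a pre-simplicial set. -/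
def chainBoundary (X : PreSimplicialObject (Type w)) (k : ℕ) :
    (X.obj (k + 1) →₀ ℤ) →ₗ[ℤ] (X.obj k →₀ ℤ) :=
  ∑ i : Fin (k + 2), (-1 : ℤ) ^ (i : ℕ) • Finsupp.lmapDomain ℤ ℤ (X.d i)

theorem chainBoundary_single (X : PreSimplicialObject (Type w)) {k : ℕ} (x : X.obj (k + 1)) :
    X.chainBoundary k (Finsupp.single x 1) =
      ∑ i : Fin (k + 2), (-1 : ℤ) ^ (i : ℕ) • Finsupp.single (X.d i x) 1 := by
  simp only [chainBoundary, LinearMap.sum_apply, LinearMap.smul_apply, Finsupp.lmapDomain_apply,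
    Finsupp.mapDomain_single]

/-- The pre-simplicial abelian group of integral chains of a pre-simplicial set. -/
def integralChains (X : PreSimplicialObject (Type w)) : PreSimplicialObject (ModuleCat.{w} ℤ) where
  obj k := ModuleCat.of ℤ (X.obj k →₀ ℤ)
  d i := ModuleCat.ofHom (Finsupp.lmapDomain ℤ ℤ (X.d i))
  d_comp_d {k i j} hij := by
    ext x
    have hx : X.d i (X.d j.succ x) = X.d j (X.d i.castSucc x) :=
      ConcreteCategory.congr_hom (X.d_comp_d hij) x
    simp [hx]

/-- An instance of `boundary_comp_boundary`, applied to the free abelian groups on the simplices. -/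
theorem chainBoundary_chainBoundary (X : PreSimplicialObject (Type w)) (k : ℕ)
    (z : X.obj (k + 2) →₀ ℤ) : X.chainBoundary k (X.chainBoundary (k + 1) z) = 0 := by
  have h (k : ℕ) : X.integralChains.boundary k = ModuleCat.ofHom (X.chainBoundary k) := by
    ext : 1
    exact (ModuleCat.hom_sum _ _).trans (Finset.sum_congr rfl fun i _ => ModuleCat.hom_zsmul _ _)
  have := X.integralChains.boundary_comp_boundary k
  rw [h, h] at this
  exact ConcreteCategory.congr_hom this z

/-- The sum of the coefficients of a chain. -/
def augmentation (J : Type w) : (J →₀ ℤ) →ₗ[ℤ] ℤ :=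
  Finsupp.linearCombination ℤ fun _ => 1

@[simp]
theorem augmentation_single {J : Type w} (x : J) (c : ℤ) :
    augmentation J (Finsupp.single x c) = c := by
  simp [augmentation]

theorem augmentation_chainBoundary (X : PreSimplicialObject (Type w)) (z : X.obj 1 →₀ ℤ) :
    augmentation _ (X.chainBoundary 0 z) = 0 := by
  have : augmentation _ ∘ₗ X.chainBoundary 0 = 0 := by
    ext x
    simp [chainBoundary_single, Fin.sum_univ_two]
  exact LinearMap.congr_fun this z

variable {C : Type w'} [Preorder C]

theorem isFiltered_chainBoundary {X : PreSimplicialObject (Type w)} {ℓ : ∀ k, X.obj k → C}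
    (hℓ : ∀ {k : ℕ} (i : Fin (k + 2)) (x : X.obj (k + 1)), ℓ (k + 1) x ≤ ℓ k (X.d i x)) (k : ℕ) :
    IsFiltered (ℓ (k + 1)) (ℓ k) (X.chainBoundary k) := by
  intro x
  rw [chainBoundary_single]
  exact Submodule.sum_mem _ fun i _ => Submodule.smul_mem _ _ (single_mem_chainsAbove (hℓ i x) 1)

/-- A pre-simplicial set with labels in a preorder is acyclic if, for each `p`, the simplices with
label above `p` have the integral homology of a point. -/
structure IsAcyclic (X : PreSimplicialObject (Type w)) (ℓ : ∀ k, X.obj k → C) : Prop where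
  exists_point : ∀ p, ∃ b ∈ chainsAbove (ℓ 0) p, augmentation _ b = 1
  exact_zero : ∀ p, ∀ z ∈ chainsAbove (ℓ 0) p, augmentation _ z = 0 →
    ∃ y ∈ chainsAbove (ℓ 1) p, X.chainBoundary 0 y = z
  exact_succ : ∀ (k : ℕ) (p), ∀ z ∈ chainsAbove (ℓ (k + 1)) p, X.chainBoundary k z = 0 →
    ∃ y ∈ chainsAbove (ℓ (k + 2)) p, X.chainBoundary (k + 1) y = z

variable {X Y : PreSimplicialObject (Type w)} {ℓX : ∀ k, X.obj k → C} {ℓY : ∀ k, Y.obj k → C}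

/-- A chain `y` in the chains above `p` with `∂ y = z`, and `0` if there is none. -/
def primitive (ℓY : ∀ k, Y.obj k → C) (k : ℕ) (p : C) (z : Y.obj k →₀ ℤ) :
    Y.obj (k + 1) →₀ ℤ :=
  open Classical in
  if h : ∃ y ∈ chainsAbove (ℓY (k + 1)) p, Y.chainBoundary k y = z then h.choose else 0

/-- The default value `0` also lies above `p`, so no cycle hypothesis is needed. Maps built from
primitives are therefore filtered before they are known to satisfy any boundary identity. -/
theorem primitive_mem (k : ℕ) (p : C) (z : Y.obj k →₀ ℤ) :
    primitive ℓY k p z ∈ chainsAbove (ℓY (k + 1)) p := by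
  unfold primitive
  split_ifs with h
  · exact h.choose_spec.1
  · exact Submodule.zero_mem _

theorem chainBoundary_primitive {k : ℕ} {p : C} {z : Y.obj k →₀ ℤ}
    (h : ∃ y ∈ chainsAbove (ℓY (k + 1)) p, Y.chainBoundary k y = z) :
    Y.chainBoundary k (primitive ℓY k p z) = z := by
  rw [primitive, dif_pos h]
  exact h.choose_spec.2

/-- A family of filtered maps of integral chains that preserves the augmentation and commutes with
the boundaries. -/
structure IsFilteredChainMap (ℓX : ∀ k, X.obj k → C) (ℓY : ∀ k, Y.obj k → C)
    (f : ∀ k, (X.obj k →₀ ℤ) →ₗ[ℤ] (Y.obj k →₀ ℤ)) : Prop where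
  isFiltered : ∀ k, IsFiltered (ℓX k) (ℓY k) (f k)
  augmentation_map : ∀ z, augmentation _ (f 0 z) = augmentation _ z
  comm : ∀ k z, Y.chainBoundary k (f (k + 1) z) = f k (X.chainBoundary k z)

theorem IsFilteredChainMap.id (ℓX : ∀ k, X.obj k → C) :
    IsFilteredChainMap ℓX ℓX fun _ => LinearMap.id :=
  ⟨fun k => IsFiltered.id (ℓX k), fun _ => rfl, fun _ _ => rfl⟩

theorem IsFilteredChainMap.comp {Z : PreSimplicialObject (Type w)} {ℓZ : ∀ k, Z.obj k → C}
    {g : ∀ k, (Y.obj k →₀ ℤ) →ₗ[ℤ] (Z.obj k →₀ ℤ)} {f : ∀ k, (X.obj k →₀ ℤ) →ₗ[ℤ] (Y.obj k →₀ ℤ)}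
    (hg : IsFilteredChainMap ℓY ℓZ g) (hf : IsFilteredChainMap ℓX ℓY f) :
    IsFilteredChainMap ℓX ℓZ fun k => g k ∘ₗ f k :=
  ⟨fun k => (hg.isFiltered k).comp (hf.isFiltered k),
    fun z => by simp [hg.augmentation_map, hf.augmentation_map],
    fun k z => by simp [hg.comm, hf.comm]⟩

/-- The chain map into an acyclic pre-simplicial set, by recursion on the degree. -/
def carriedMap (hY : IsAcyclic Y ℓY) (ℓX : ∀ k, X.obj k → C) :
    ∀ k, (X.obj k →₀ ℤ) →ₗ[ℤ] (Y.obj k →₀ ℤ)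
  | 0 => Finsupp.linearCombination ℤ fun x => (hY.exists_point (ℓX 0 x)).choose
  | k + 1 => Finsupp.linearCombination ℤ fun x =>
      primitive ℓY k (ℓX (k + 1) x)
        (carriedMap hY ℓX k (X.chainBoundary k (Finsupp.single x 1)))

theorem isFiltered_carriedMap (hY : IsAcyclic Y ℓY) (k : ℕ) :
    IsFiltered (ℓX k) (ℓY k) (carriedMap hY ℓX k) := by
  intro x
  cases k with
  | zero => simpa [carriedMap] using (hY.exists_point (ℓX 0 x)).choose_spec.1
  | succ k => simpa [carriedMap] using primitive_mem _ _ _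

theorem augmentation_carriedMap (hY : IsAcyclic Y ℓY) (z : X.obj 0 →₀ ℤ) :
    augmentation _ (carriedMap hY ℓX 0 z) = augmentation _ z := by
  have : augmentation _ ∘ₗ carriedMap hY ℓX 0 = augmentation _ := by
    ext x
    simpa [carriedMap] using (hY.exists_point (ℓX 0 x)).choose_spec.2
  exact LinearMap.congr_fun this z

/-- The image of `∂x` lies above the label of `x` and is a cycle by the square one degree lower (in
degree `0`: its augmentation vanishes). Acyclicity then makes the chosen primitive a genuine one. -/
theorem carriedMap_comm
    (hX : ∀ {k : ℕ} (i : Fin (k + 2)) (x : X.obj (k + 1)), ℓX (k + 1) x ≤ ℓX k (X.d i x))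
    (hY : IsAcyclic Y ℓY) (k : ℕ) (z : X.obj (k + 1) →₀ ℤ) :
    Y.chainBoundary k (carriedMap hY ℓX (k + 1) z) = carriedMap hY ℓX k (X.chainBoundary k z) := by
  suffices h : Y.chainBoundary k ∘ₗ carriedMap hY ℓX (k + 1) =
      carriedMap hY ℓX k ∘ₗ X.chainBoundary k from LinearMap.congr_fun h z
  clear z
  have single (k : ℕ) (x : X.obj (k + 1)) : carriedMap hY ℓX (k + 1) (Finsupp.single x 1) =
      primitive ℓY k (ℓX (k + 1) x)
        (carriedMap hY ℓX k (X.chainBoundary k (Finsupp.single x 1))) := by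
    rw [carriedMap, Finsupp.linearCombination_single, one_smul]
  induction k with
  | zero =>
    ext x : 2
    simp only [LinearMap.comp_apply, Finsupp.lsingle_apply]
    rw [single]
    refine chainBoundary_primitive (hY.exact_zero _ _ ?_ ?_)
    · exact (isFiltered_carriedMap hY 0).map_mem (isFiltered_chainBoundary hX 0 x)
    · rw [augmentation_carriedMap, augmentation_chainBoundary]
  | succ k ih =>
    ext x : 2
    simp only [LinearMap.comp_apply, Finsupp.lsingle_apply]
    rw [single]
    refine chainBoundary_primitive (hY.exact_succ _ _ _ ?_ ?_)
    · exact (isFiltered_carriedMap hY (k + 1)).map_mem (isFiltered_chainBoundary hX (k + 1) x)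
    · rw [← LinearMap.comp_apply, ih, LinearMap.comp_apply, chainBoundary_chainBoundary, map_zero]

theorem isFilteredChainMap_carriedMap
    (hX : ∀ {k : ℕ} (i : Fin (k + 2)) (x : X.obj (k + 1)), ℓX (k + 1) x ≤ ℓX k (X.d i x))
    (hY : IsAcyclic Y ℓY) : IsFilteredChainMap ℓX ℓY (carriedMap hY ℓX) :=
  ⟨isFiltered_carriedMap hY, augmentation_carriedMap hY, carriedMap_comm hX hY⟩

/-- The homotopy between two chain maps `f`, `g` into an acyclic pre-simplicial set, by recursion
on the degree. -/
def carriedHomotopy (ℓX : ∀ k, X.obj k → C) (ℓY : ∀ k, Y.obj k → C)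
    (f g : ∀ k, (X.obj k →₀ ℤ) →ₗ[ℤ] (Y.obj k →₀ ℤ)) :
    ∀ k, (X.obj k →₀ ℤ) →ₗ[ℤ] (Y.obj (k + 1) →₀ ℤ)
  | 0 => Finsupp.linearCombination ℤ fun x =>
      primitive ℓY 0 (ℓX 0 x) (f 0 (Finsupp.single x 1) - g 0 (Finsupp.single x 1))
  | k + 1 => Finsupp.linearCombination ℤ fun x =>
      primitive ℓY (k + 1) (ℓX (k + 1) x)
        (f (k + 1) (Finsupp.single x 1) - g (k + 1) (Finsupp.single x 1) -
          carriedHomotopy ℓX ℓY f g k (X.chainBoundary k (Finsupp.single x 1)))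

theorem isFiltered_carriedHomotopy (f g : ∀ k, (X.obj k →₀ ℤ) →ₗ[ℤ] (Y.obj k →₀ ℤ)) (k : ℕ) :
    IsFiltered (ℓX k) (ℓY (k + 1)) (carriedHomotopy ℓX ℓY f g k) := by
  intro x
  cases k <;> simpa [carriedHomotopy] using primitive_mem _ _ _

section

variable {f g : ∀ k, (X.obj k →₀ ℤ) →ₗ[ℤ] (Y.obj k →₀ ℤ)}

/-- Both maps preserve the augmentation, so their difference on a vertex has augmentation zero and
bounds. -/
theorem chainBoundary_carriedHomotopy_zero (hY : IsAcyclic Y ℓY)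
    (hf : IsFilteredChainMap ℓX ℓY f) (hg : IsFilteredChainMap ℓX ℓY g) :
    f 0 = Y.chainBoundary 0 ∘ₗ carriedHomotopy ℓX ℓY f g 0 + g 0 := by
  rw [← sub_eq_iff_eq_add]
  ext x : 2
  simp only [LinearMap.comp_apply, LinearMap.sub_apply, Finsupp.lsingle_apply]
  rw [carriedHomotopy, Finsupp.linearCombination_single, one_smul]
  refine (chainBoundary_primitive (hY.exact_zero _ _ ?_ ?_)).symm
  · exact Submodule.sub_mem _ (hf.isFiltered 0 x) (hg.isFiltered 0 x)
  · rw [map_sub, hf.augmentation_map, hg.augmentation_map, sub_self]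

theorem chainBoundary_carriedHomotopy_succ
    (hX : ∀ {k : ℕ} (i : Fin (k + 2)) (x : X.obj (k + 1)), ℓX (k + 1) x ≤ ℓX k (X.d i x))
    (hY : IsAcyclic Y ℓY) (hf : IsFilteredChainMap ℓX ℓY f) (hg : IsFilteredChainMap ℓX ℓY g)
    (k : ℕ) :
    f (k + 1) = carriedHomotopy ℓX ℓY f g k ∘ₗ X.chainBoundary k +
      Y.chainBoundary (k + 1) ∘ₗ carriedHomotopy ℓX ℓY f g (k + 1) + g (k + 1) := by
  -- The homotopy identity follows from the cycle condition in the same degree. The induction below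
  -- runs on the cycle condition, which in turn uses the homotopy identity one degree lower, applied
  -- to `∂x`.
  have step (k : ℕ) (h : ∀ x, Y.chainBoundary k (f (k + 1) (Finsupp.single x 1) -
      g (k + 1) (Finsupp.single x 1) -
      carriedHomotopy ℓX ℓY f g k (X.chainBoundary k (Finsupp.single x 1))) = 0) :
      f (k + 1) = carriedHomotopy ℓX ℓY f g k ∘ₗ X.chainBoundary k +
        Y.chainBoundary (k + 1) ∘ₗ carriedHomotopy ℓX ℓY f g (k + 1) + g (k + 1) := by
    rw [← sub_eq_iff_eq_add, ← sub_eq_iff_eq_add']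
    ext x : 2
    simp only [LinearMap.comp_apply, LinearMap.sub_apply, Finsupp.lsingle_apply]
    rw [carriedHomotopy, Finsupp.linearCombination_single, one_smul]
    refine (chainBoundary_primitive (hY.exact_succ _ _ _ ?_ (h x))).symm
    exact Submodule.sub_mem _
      (Submodule.sub_mem _ (hf.isFiltered _ x) (hg.isFiltered _ x))
      ((isFiltered_carriedHomotopy f g k).map_mem (isFiltered_chainBoundary hX k x))
  refine step k ?_
  induction k with
  | zero =>
    intro x
    have h := LinearMap.congr_fun (chainBoundary_carriedHomotopy_zero hY hf hg)
      (X.chainBoundary 0 (Finsupp.single x 1))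
    simp only [LinearMap.add_apply, LinearMap.comp_apply] at h
    rw [map_sub, map_sub, hf.comm, hg.comm, h]
    abel
  | succ k ih =>
    intro x
    have h := LinearMap.congr_fun (step k ih) (X.chainBoundary (k + 1) (Finsupp.single x 1))
    simp only [LinearMap.add_apply, LinearMap.comp_apply, chainBoundary_chainBoundary,
      map_zero, zero_add] at h
    rw [map_sub, map_sub, hf.comm, hg.comm, h]
    abel

end

end Acyclic

/-! ### Homotopy equivalence of the complexes with coefficients -/

section Realization

variable {C : Type w'} [Preorder C] {A : Type u} [Category.{v} A] [Preadditive A]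
  [HasCoproducts.{w} A] (F : C ⥤ A)
  {X Y : PreSimplicialObject (Type w)} {ℓX : ∀ k, X.obj k → C} {ℓY : ∀ k, Y.obj k → C}
  (hX : ∀ {k : ℕ} (i : Fin (k + 2)) (x : X.obj (k + 1)), ℓX (k + 1) x ≤ ℓX k (X.d i x))
  (hY : ∀ {k : ℕ} (i : Fin (k + 2)) (y : Y.obj (k + 1)), ℓY (k + 1) y ≤ ℓY k (Y.d i y))

theorem boundary_withCoefficients (k : ℕ) :
    (X.withCoefficients ℓX hX F).boundary k =
      coeffMap F (ℓX (k + 1)) (ℓX k) (X.chainBoundary k) := by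
  apply Sigma.hom_ext
  intro x
  refine Eq.trans ?_ (ι_coeffMap F _ x).symm
  rw [chainBoundary_single, map_sum]
  refine (Preadditive.comp_sum _ _ _).trans (Finset.sum_congr rfl fun i _ => ?_)
  rw [map_zsmul, chainInclusion_single F (hX i x)]
  refine (Preadditive.comp_zsmul _ _ _).trans (congrArg _ ?_)
  exact colimit.ι_desc _ _

theorem chainComplex_d_withCoefficients (k : ℕ) :
    (X.withCoefficients ℓX hX F).chainComplex.d (k + 1) k =
      coeffMap F (ℓX (k + 1)) (ℓX k) (X.chainBoundary k) :=
  (ChainComplex.of_d _ _ k).trans (boundary_withCoefficients F hX k)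

/-- The morphism of complexes with coefficients given by a filtered chain map. -/
def coeffChainMap {f : ∀ k, (X.obj k →₀ ℤ) →ₗ[ℤ] (Y.obj k →₀ ℤ)}
    (hf : IsFilteredChainMap ℓX ℓY f) :
    (X.withCoefficients ℓX hX F).chainComplex ⟶ (Y.withCoefficients ℓY hY F).chainComplex :=
  ChainComplex.ofHom (fun k => coeffMap F (ℓX k) (ℓY k) (f k)) fun k => by
    rw [chainComplex_d_withCoefficients, chainComplex_d_withCoefficients]
    refine (coeffMap_comp F (hf.isFiltered _) (isFiltered_chainBoundary hY k)).symm.trans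
      (Eq.trans ?_ (coeffMap_comp F (isFiltered_chainBoundary hX k) (hf.isFiltered _)))
    exact congrArg _ (LinearMap.ext (hf.comm k))

/-- Two filtered chain maps into an acyclic pre-simplicial set induce homotopic morphisms of
complexes with coefficients. -/
def coeffHomotopy (acY : IsAcyclic Y ℓY) {f g : ∀ k, (X.obj k →₀ ℤ) →ₗ[ℤ] (Y.obj k →₀ ℤ)}
    (hf : IsFilteredChainMap ℓX ℓY f) (hg : IsFilteredChainMap ℓX ℓY g) :
    Homotopy (coeffChainMap F hX hY hf) (coeffChainMap F hX hY hg) where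
  -- A homotopy has a component for every pair of degrees, so the one of degree `+1` is transported
  -- along `i + 1 = j`.
  hom i j := if h : i + 1 = j then
    (show (X.withCoefficients ℓX hX F).chainComplex.X i ⟶
      (Y.withCoefficients ℓY hY F).chainComplex.X (i + 1) from
      coeffMap F (ℓX i) (ℓY (i + 1)) (carriedHomotopy ℓX ℓY f g i)) ≫ eqToHom (by rw [h]) else 0
  zero i j h := dif_neg h
  comm k := by
    rw [Homotopy.prevD_chainComplex, dif_pos rfl,
      chainComplex_d_withCoefficients, eqToHom_refl, Category.comp_id]
    cases k with
    | zero =>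
      rw [Homotopy.dNext_zero_chainComplex, zero_add]
      refine (congrArg (coeffMap F (ℓX 0) (ℓY 0))
        (chainBoundary_carriedHomotopy_zero acY hf hg)).trans ?_
      refine (coeffMap_add F _ _).trans (congrArg (· + _) ?_)
      exact coeffMap_comp F (isFiltered_carriedHomotopy f g 0) (isFiltered_chainBoundary hY 0)
    | succ k =>
      rw [Homotopy.dNext_succ_chainComplex, dif_pos rfl,
        chainComplex_d_withCoefficients, eqToHom_refl, Category.comp_id]
      refine (congrArg (coeffMap F (ℓX (k + 1)) (ℓY (k + 1)))
        (chainBoundary_carriedHomotopy_succ hX acY hf hg k)).trans ?_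
      refine (coeffMap_add F _ _).trans (congrArg (· + _) ?_)
      refine (coeffMap_add F _ _).trans (congrArg₂ (· + ·) ?_ ?_)
      · exact coeffMap_comp F (isFiltered_chainBoundary hX k) (isFiltered_carriedHomotopy f g k)
      · exact coeffMap_comp F (isFiltered_carriedHomotopy f g (k + 1))
          (isFiltered_chainBoundary hY (k + 1))

theorem coeffChainMap_comp {Z : PreSimplicialObject (Type w)} {ℓZ : ∀ k, Z.obj k → C}
    (hZ : ∀ {k : ℕ} (i : Fin (k + 2)) (z : Z.obj (k + 1)), ℓZ (k + 1) z ≤ ℓZ k (Z.d i z))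
    {f : ∀ k, (X.obj k →₀ ℤ) →ₗ[ℤ] (Y.obj k →₀ ℤ)} {g : ∀ k, (Y.obj k →₀ ℤ) →ₗ[ℤ] (Z.obj k →₀ ℤ)}
    (hf : IsFilteredChainMap ℓX ℓY f) (hg : IsFilteredChainMap ℓY ℓZ g) :
    coeffChainMap F hX hZ (hg.comp hf) = coeffChainMap F hX hY hf ≫ coeffChainMap F hY hZ hg := by
  ext k : 1
  exact coeffMap_comp F (hf.isFiltered k) (hg.isFiltered k)

theorem coeffChainMap_id : coeffChainMap F hX hX (IsFilteredChainMap.id ℓX) = 𝟙 _ := by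
  ext k : 1
  exact coeffMap_id F (ℓX k)

/-- The complexes with coefficients of two acyclic pre-simplicial sets are homotopy equivalent. -/
def homotopyEquivOfIsAcyclic (acX : IsAcyclic X ℓX) (acY : IsAcyclic Y ℓY) :
    HomotopyEquiv (X.withCoefficients ℓX hX F).chainComplex
      (Y.withCoefficients ℓY hY F).chainComplex :=
  have hf := isFilteredChainMap_carriedMap hX acY
  have hg := isFilteredChainMap_carriedMap hY acX
  { hom := coeffChainMap F hX hY hf
    inv := coeffChainMap F hY hX hg
    -- The round trip and the identity are both filtered chain maps into the same acyclic object,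
    -- hence homotopic.
    homotopyHomInvId :=
      (Homotopy.ofEq (coeffChainMap_comp F hX hY hX hf hg).symm).trans
        ((coeffHomotopy F hX hX acX (hg.comp hf) (IsFilteredChainMap.id ℓX)).trans
          (Homotopy.ofEq (coeffChainMap_id F hX)))
    homotopyInvHomId :=
      (Homotopy.ofEq (coeffChainMap_comp F hY hX hY hg hf).symm).trans
        ((coeffHomotopy F hY hY acY (hf.comp hg) (IsFilteredChainMap.id ℓY)).trans
          (Homotopy.ofEq (coeffChainMap_id F hY))) }

end Realization

/-! ### Acyclicity from contractions -/

section Contraction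

variable {C : Type w'} [Preorder C]

/-- Acyclicity follows from a contraction of the chains above each element. -/
theorem IsAcyclic.of_contraction {X : PreSimplicialObject (Type w)} {ℓ : ∀ k, X.obj k → C}
    (H : ∀ p, ∃ (b : X.obj 0) (s : ∀ k, (X.obj k →₀ ℤ) →ₗ[ℤ] (X.obj (k + 1) →₀ ℤ)), p ≤ ℓ 0 b ∧
      (∀ k x, p ≤ ℓ k x → s k (Finsupp.single x 1) ∈ chainsAbove (ℓ (k + 1)) p) ∧
      (∀ x, p ≤ ℓ 0 x → X.chainBoundary 0 (s 0 (Finsupp.single x 1)) =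
        Finsupp.single x 1 - Finsupp.single b 1) ∧
      ∀ k x, p ≤ ℓ (k + 1) x → X.chainBoundary (k + 1) (s (k + 1) (Finsupp.single x 1)) =
        Finsupp.single x 1 - s k (X.chainBoundary k (Finsupp.single x 1))) :
    IsAcyclic X ℓ := by
  have mem {p : C} {k : ℕ} {s : (X.obj k →₀ ℤ) →ₗ[ℤ] (X.obj (k + 1) →₀ ℤ)}
      (hs : ∀ x, p ≤ ℓ k x → s (Finsupp.single x 1) ∈ chainsAbove (ℓ (k + 1)) p)
      {z : X.obj k →₀ ℤ} (hz : z ∈ chainsAbove (ℓ k) p) : s z ∈ chainsAbove (ℓ (k + 1)) p :=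
    (chainsAbove_le_iff (S := (chainsAbove (ℓ (k + 1)) p).comap s)).mpr hs hz
  refine ⟨fun p => ?_, fun p z hz hz0 => ?_, fun k p z hz hz0 => ?_⟩
  · obtain ⟨b, s, hb, -⟩ := H p
    exact ⟨_, single_mem_chainsAbove hb 1, augmentation_single b 1⟩
  · obtain ⟨b, s, hb, hs, h0, -⟩ := H p
    refine ⟨s 0 z, mem (hs 0) hz, ?_⟩
    -- Extended linearly, the base point becomes augmentation times `b`, which vanishes on `z`.
    have := eqOn_chainsAbove (φ := X.chainBoundary 0 ∘ₗ s 0)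
      (ψ := LinearMap.id - (augmentation _).smulRight (Finsupp.single b 1))
      (fun x hx => by simpa using h0 x hx) hz
    simpa [hz0] using this
  · obtain ⟨b, s, hb, hs, -, h1⟩ := H p
    refine ⟨s (k + 1) z, mem (hs (k + 1)) hz, ?_⟩
    have := eqOn_chainsAbove (φ := X.chainBoundary (k + 1) ∘ₗ s (k + 1))
      (ψ := LinearMap.id - s k ∘ₗ X.chainBoundary k)
      (fun x hx => by simpa using h1 k x hx) hz
    simpa [hz0] using this

end Contraction

/-! ### Cones on strict chains -/

section StrictChains

variable {P : Type w} [PartialOrder P]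

/-- The least entry of a strict chain. -/
def strictHead {k : ℕ} (x : (strictChains P).obj k) : P :=
  (show Fin (k + 1) ↪o P from x) 0

theorem strictChains_ext {k : ℕ} {x y : (strictChains P).obj k}
    (h : ∀ i, (show Fin (k + 1) ↪o P from x) i = (show Fin (k + 1) ↪o P from y) i) : x = y :=
  DFunLike.ext (F := Fin (k + 1) ↪o P) _ _ h

/-- The strict chain `v < x₀ < ⋯ < xₖ`. -/
def strictCone {k : ℕ} (v : P) (x : (strictChains P).obj k) (h : v < strictHead x) :
    (strictChains P).obj (k + 1) :=
  OrderEmbedding.ofStrictMono (Fin.cons v (show Fin (k + 1) ↪o P from x) : Fin (k + 2) → P) <| by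
    rw [Fin.strictMono_iff_lt_succ]
    intro i
    cases i using Fin.cases with
    | zero => exact h
    | succ i => exact (show Fin (k + 1) ↪o P from x).strictMono i.castSucc_lt_succ

theorem strictHead_le_strictHead_d {k : ℕ} (x : (strictChains P).obj (k + 1)) (i : Fin (k + 2)) :
    strictHead x ≤ strictHead ((strictChains P).d i x) :=
  (show Fin (k + 2) ↪o P from x).monotone (Fin.zero_le (i.succAbove 0))

theorem d_zero_strictCone {k : ℕ} (v : P) (x : (strictChains P).obj k) (h : v < strictHead x) :
    (strictChains P).d 0 (strictCone v x h) = x :=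
  strictChains_ext fun i => Fin.cons_succ (α := fun _ => P) v _ i

theorem d_succ_strictCone {k : ℕ} (v : P) (x : (strictChains P).obj (k + 1))
    (h : v < strictHead x) (i : Fin (k + 2)) :
    (strictChains P).d i.succ (strictCone v x h) =
      strictCone v ((strictChains P).d i x) (h.trans_le (strictHead_le_strictHead_d x i)) := by
  refine strictChains_ext fun j => ?_
  change (Fin.cons v (show Fin (k + 2) ↪o P from x) : Fin (k + 3) → P) (i.succ.succAbove j) =
    (Fin.cons v fun t => (show Fin (k + 2) ↪o P from x) (i.succAbove t) : Fin (k + 2) → P) j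
  cases j using Fin.cases with
  | zero => rw [Fin.succ_succAbove_zero, Fin.cons_zero, Fin.cons_zero]
  | succ j => rw [Fin.succ_succAbove_succ, Fin.cons_succ, Fin.cons_succ]

/-- The strict chain with one element. -/
def strictPoint (v : P) : (strictChains P).obj 0 :=
  OrderEmbedding.ofStrictMono (fun _ : Fin 1 => v)
    (@Subsingleton.strictMono (Fin 1) P _ _ _ _)

theorem strictPoint_strictHead (x : (strictChains P).obj 0) : strictPoint (strictHead x) = x :=
  strictChains_ext fun i =>
    congrArg (show Fin 1 ↪o P from x) (Subsingleton.elim (α := Fin 1) 0 i)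

theorem d_one_strictCone (v : P) (x : (strictChains P).obj 0) (h : v < strictHead x) :
    (strictChains P).d 1 (strictCone v x h) = strictPoint v :=
  (strictPoint_strictHead _).symm

/-- The join with a vertex on the integral chains of strict chains; it is zero on the chains that do
not start above the vertex. -/
def strictConeMap (v : P) (k : ℕ) :
    ((strictChains P).obj k →₀ ℤ) →ₗ[ℤ] ((strictChains P).obj (k + 1) →₀ ℤ) :=
  open Classical in
  Finsupp.linearCombination ℤ fun x =>
    if h : v < strictHead x then Finsupp.single (strictCone v x h) 1 else 0

theorem strictConeMap_single {v : P} {k : ℕ} {x : (strictChains P).obj k} (h : v < strictHead x) :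
    strictConeMap v k (Finsupp.single x 1) = Finsupp.single (strictCone v x h) 1 := by
  rw [strictConeMap, Finsupp.linearCombination_single, one_smul, dif_pos h]

theorem strictConeMap_single_of_not_lt {v : P} {k : ℕ} {x : (strictChains P).obj k}
    (h : ¬ v < strictHead x) : strictConeMap v k (Finsupp.single x 1) = 0 := by
  rw [strictConeMap, Finsupp.linearCombination_single, one_smul, dif_neg h]

theorem chainBoundary_strictConeMap_zero {v : P} {x : (strictChains P).obj 0}
    (h : v ≤ strictHead x) :
    (strictChains P).chainBoundary 0 (strictConeMap v 0 (Finsupp.single x 1)) =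
      Finsupp.single x 1 - Finsupp.single (strictPoint v) 1 := by
  by_cases hlt : v < strictHead x
  · rw [strictConeMap_single hlt, chainBoundary_single, Fin.sum_univ_two, d_zero_strictCone,
      d_one_strictCone]
    simp [sub_eq_add_neg]
  · rw [strictConeMap_single_of_not_lt hlt, map_zero, h.eq_of_not_lt hlt, strictPoint_strictHead,
      sub_self]

/-- If `x` starts strictly above `v`, this is the usual cone formula. If `x` starts at `v`, its cone
is zero; among its faces only `d₀ x` does not start at `v`, and the cone on that face is `x` itself.
-/
theorem chainBoundary_strictConeMap_succ {v : P} {k : ℕ} {x : (strictChains P).obj (k + 1)}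
    (h : v ≤ strictHead x) :
    (strictChains P).chainBoundary (k + 1) (strictConeMap v (k + 1) (Finsupp.single x 1)) =
      Finsupp.single x 1 -
        strictConeMap v k ((strictChains P).chainBoundary k (Finsupp.single x 1)) := by
  by_cases hlt : v < strictHead x
  · rw [strictConeMap_single hlt, chainBoundary_single, chainBoundary_single, Fin.sum_univ_succ,
      d_zero_strictCone, map_sum, sub_eq_add_neg, ← Finset.sum_neg_distrib]
    congr 1
    · simp
    · refine Finset.sum_congr rfl fun i _ => ?_
      rw [d_succ_strictCone, map_zsmul,
        strictConeMap_single (hlt.trans_le (strictHead_le_strictHead_d x i)),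
        Fin.val_succ, pow_succ, mul_neg_one, neg_smul]
  · obtain rfl := h.eq_of_not_lt hlt
    have h0 : strictHead x < strictHead ((strictChains P).d 0 x) :=
      (show Fin (k + 2) ↪o P from x).strictMono (Fin.succ_pos 0)
    have hx : strictCone (strictHead x) ((strictChains P).d 0 x) h0 = x :=
      strictChains_ext fun j => by cases j using Fin.cases <;> rfl
    rw [strictConeMap_single_of_not_lt hlt, map_zero, chainBoundary_single, Fin.sum_univ_succ,
      map_add, map_sum, Finset.sum_eq_zero, add_zero, map_zsmul, strictConeMap_single h0, hx]
    · simp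
    · intro i _
      rw [map_zsmul, strictConeMap_single_of_not_lt, smul_zero]
      exact hlt

/-- Strict chains are acyclic if, for each `p`, the chains with label above `p` are those contained
in a set with a least element. -/
theorem isAcyclic_strictChains {C : Type w'} [Preorder C] (ℓ : ∀ k, (strictChains P).obj k → C)
    (H : ∀ p, ∃ (T : Set P) (v : P), IsLeast T v ∧
      ∀ k (x : Fin (k + 1) ↪o P), p ≤ ℓ k x ↔ ∀ i, x i ∈ T) :
    IsAcyclic (strictChains P) ℓ := by
  refine IsAcyclic.of_contraction fun p => ?_
  obtain ⟨T, v, hv, hT⟩ := H p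
  -- The apex is the least element of `T`: adjoining it keeps a chain inside `T`, and every chain in
  -- `T` starts at or above it.
  refine ⟨strictPoint v, strictConeMap v, (hT 0 _).mpr fun _ => hv.1,
    fun k x hx => ?_, fun x hx => ?_, fun k x hx => ?_⟩
  · by_cases hlt : v < strictHead x
    · rw [strictConeMap_single hlt]
      refine single_mem_chainsAbove ((hT _ _).mpr fun i => ?_) 1
      cases i using Fin.cases with
      | zero => exact hv.1
      | succ i => exact (hT _ _).mp hx i
    · rw [strictConeMap_single_of_not_lt hlt]
      exact Submodule.zero_mem _
  · exact chainBoundary_strictConeMap_zero (hv.2 ((hT _ _).mp hx 0))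
  · exact chainBoundary_strictConeMap_succ (hv.2 ((hT _ _).mp hx 0))

end StrictChains

/-! ### Cones on the nerve of a preorder -/

section NerveChains

variable {P : Type w} [Preorder P]

theorem composableArrows_ext {k : ℕ} {x y : ComposableArrows P k} (h : ∀ i, x.obj i = y.obj i) :
    x = y :=
  CategoryTheory.Functor.ext h fun _ _ _ => Subsingleton.elim _ _

/-- The pre-simplicial set underlying the nerve of a preorder. -/
def nerveChains (P : Type w) [Preorder P] : PreSimplicialObject (Type w) where
  obj k := ComposableArrows P k
  d i := ↾fun x => nerveReindex x (Fin.succAboveOrderEmb i).toOrderHom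
  d_comp_d {k i j} hij := by
    ext x
    refine composableArrows_ext fun a => ?_
    have h := congr_arg (fun f => SimplexCategory.Hom.toOrderHom f a)
      (SimplexCategory.δ_comp_δ hij)
    exact congr_arg x.obj h

/-- The leading object of a string of composable arrows. -/
def nerveLabel (P : Type w) [Preorder P] (k : ℕ) (x : (nerveChains P).obj k) : P :=
  (show ComposableArrows P k from x).obj 0

theorem nerveLabel_le {k : ℕ} (i : Fin (k + 2)) (x : (nerveChains P).obj (k + 1)) :
    nerveLabel P (k + 1) x ≤ nerveLabel P k ((nerveChains P).d i x) :=
  leOfHom (nerveLeadingMap (show ComposableArrows P (k + 1) from x)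
    (Fin.succAboveOrderEmb i).toOrderHom)

/-- The string `p ⟶ x₀ ⟶ ⋯ ⟶ xₖ`. -/
def nerveCone {k : ℕ} (p : P) (x : (nerveChains P).obj k) (h : p ≤ nerveLabel P k x) :
    (nerveChains P).obj (k + 1) :=
  ComposableArrows.precomp (show ComposableArrows P k from x) (homOfLE h)

theorem d_zero_nerveCone {k : ℕ} (p : P) (x : (nerveChains P).obj k)
    (h : p ≤ nerveLabel P k x) : (nerveChains P).d 0 (nerveCone p x h) = x :=
  composableArrows_ext fun _ => rfl

theorem d_succ_nerveCone {k : ℕ} (p : P) (x : (nerveChains P).obj (k + 1))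
    (h : p ≤ nerveLabel P (k + 1) x) (i : Fin (k + 2)) :
    (nerveChains P).d i.succ (nerveCone p x h) =
      nerveCone p ((nerveChains P).d i x) (h.trans (nerveLabel_le i x)) := by
  refine composableArrows_ext fun j => ?_
  change ComposableArrows.Precomp.obj (show ComposableArrows P (k + 1) from x) p
    (i.succ.succAbove j) = _
  cases j using Fin.cases with
  | zero => rw [Fin.succ_succAbove_zero]; rfl
  | succ j => rw [Fin.succ_succAbove_succ]; rfl

theorem d_one_nerveCone (p : P) (x : (nerveChains P).obj 0) (h : p ≤ nerveLabel P 0 x) :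
    (nerveChains P).d 1 (nerveCone p x h) = ComposableArrows.mk₀ p := by
  refine composableArrows_ext fun j => ?_
  rw [Subsingleton.elim (α := Fin 1) j 0]
  rfl

/-- The join with an object on the integral chains of the nerve; it is zero on the strings that do
not start above the object. -/
def nerveConeMap (p : P) (k : ℕ) :
    ((nerveChains P).obj k →₀ ℤ) →ₗ[ℤ] ((nerveChains P).obj (k + 1) →₀ ℤ) :=
  open Classical in
  Finsupp.linearCombination ℤ fun x =>
    if h : p ≤ nerveLabel P k x then Finsupp.single (nerveCone p x h) 1 else 0

theorem nerveConeMap_single {p : P} {k : ℕ} {x : (nerveChains P).obj k}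
    (h : p ≤ nerveLabel P k x) :
    nerveConeMap p k (Finsupp.single x 1) = Finsupp.single (nerveCone p x h) 1 := by
  rw [nerveConeMap, Finsupp.linearCombination_single, one_smul, dif_pos h]

/-- Strings starting above `p` form the nerve of a preorder with least element `p`. Prepending `p`
contracts it; as identities are allowed in strings, no case distinction is needed when the string
already starts at `p`. -/
theorem isAcyclic_nerveChains (P : Type w) [Preorder P] :
    IsAcyclic (nerveChains P) (nerveLabel P) := by
  refine IsAcyclic.of_contraction fun p => ⟨ComposableArrows.mk₀ p, nerveConeMap p, le_rfl,
    fun k x hx => ?_, fun x hx => ?_, fun k x hx => ?_⟩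
  · rw [nerveConeMap_single hx]
    exact single_mem_chainsAbove (ℓ := nerveLabel P (k + 1)) (le_refl p) 1
  · rw [nerveConeMap_single hx, chainBoundary_single, Fin.sum_univ_two, d_zero_nerveCone,
      d_one_nerveCone]
    simp [sub_eq_add_neg]
  · rw [nerveConeMap_single hx, chainBoundary_single, chainBoundary_single, Fin.sum_univ_succ,
      d_zero_nerveCone, map_sum, sub_eq_add_neg, ← Finset.sum_neg_distrib]
    congr 1
    · simp
    · refine Finset.sum_congr rfl fun i _ => ?_
      rw [d_succ_nerveCone, map_zsmul, nerveConeMap_single (hx.trans (nerveLabel_le i x)),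
        Fin.val_succ, pow_succ, mul_neg_one, neg_smul]

variable {A : Type u} [Category.{v} A] [HasCoproducts.{w} A] [Preadditive A]

/-- The alternating face map complex of `F(Nerve P)` is the complex of the pre-simplicial object
`F(nerveChains P)`. -/
def nerveCoeffComplexIso (F : P ⥤ A) :
    (AlgebraicTopology.alternatingFaceMapComplex A).obj (nerveCoeff F) ≅
      ((nerveChains P).withCoefficients (nerveLabel P) nerveLabel_le F).chainComplex :=
  HomologicalComplex.Hom.isoOfComponents (fun _ => Iso.refl _) <| by
    rintro i j rfl
    -- The objects agree by definition, so only the two alternating sums of faces have to be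
    -- matched.
    refine (Category.id_comp _).trans (Eq.trans ?_ (Category.comp_id _).symm)
    exact (ChainComplex.of_d _ _ _).trans
      (AlgebraicTopology.alternatingFaceMapComplex_obj_d (nerveCoeff F) j).symm

end NerveChains

end PreSimplicialObject

/-! ### Acyclicity of the subdivision and of the simplex -/

namespace SimplexCat

open PreSimplicialObject

/-- A flag whose largest face lies in `p` consists of faces of `p`. In the reversed order these
faces form `Set.Ici p`, with least element `p`. -/
theorem isAcyclic_subdiv (n : ℕ) : IsAcyclic (subdiv n) (subdivFace n) :=
  isAcyclic_strictChains _ fun p => ⟨Set.Ici p, p, isLeast_Ici, fun _ x =>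
    ⟨fun h i => le_trans h (x.monotone (Fin.zero_le i)), fun h => h 0⟩⟩

/-- A simplex is a face of `p` exactly when all its vertices lie in `p`; since `p` is non-empty, it
has a least vertex to serve as apex. -/
theorem isAcyclic_nabla (n : ℕ) : IsAcyclic (nabla n) (nablaFace n) :=
  isAcyclic_strictChains _ fun p => ⟨(OrderDual.ofDual p).1,
    (OrderDual.ofDual p).1.min' (OrderDual.ofDual p).2, Finset.isLeast_min' _ _, fun k x => by
      change Finset.univ.map x.toEmbedding ⊆ (OrderDual.ofDual p).1 ↔ _
      simp [Finset.subset_iff]⟩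

end SimplexCat

end

theorem mainTheorem1 {R : Type u} [CommRing R] (n : ℕ) (F : SimplexCat n ⥤ ModuleCat.{v} R)
    (k : ℕ) :
    Nonempty (categoryHomology F k ≅ (SimplexCat.subdivCoeff F).homology k) ∧
    Nonempty ((SimplexCat.subdivCoeff F).homology k ≅ (SimplexCat.nablaCoeff F).homology k) ∧
    Nonempty (categoryHomology F k ≅ simplicialHomology (nerveCoeff F) k) ∧
    Nonempty (simplicialHomology (nerveCoeff F) k ≅ (SimplexCat.nablaCoeff F).homology k) := by
  have nerveSubdiv : categoryHomology F k ≅ (SimplexCat.subdivCoeff F).homology k :=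
    (HomologicalComplex.homologyFunctor _ _ k).mapIso
      (PreSimplicialObject.nerveCoeffComplexIso F) ≪≫
      (PreSimplicialObject.homotopyEquivOfIsAcyclic F PreSimplicialObject.nerveLabel_le
        (SimplexCat.subdivFace_le n) (PreSimplicialObject.isAcyclic_nerveChains _)
        (SimplexCat.isAcyclic_subdiv n)).toHomologyIso k
  have subdivNabla : (SimplexCat.subdivCoeff F).homology k ≅ (SimplexCat.nablaCoeff F).homology k :=
    (PreSimplicialObject.homotopyEquivOfIsAcyclic F (SimplexCat.subdivFace_le n)
      (SimplexCat.nablaFace_le n) (SimplexCat.isAcyclic_subdiv n)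
      (SimplexCat.isAcyclic_nabla n)).toHomologyIso k
  -- `categoryHomology` is by definition the homology of `nerveCoeff`, so the third isomorphism is
  -- the identity and the fourth starts from `nerveSubdiv`.
  exact ⟨⟨nerveSubdiv⟩, ⟨subdivNabla⟩, ⟨Iso.refl _⟩, ⟨nerveSubdiv ≪≫ subdivNabla⟩⟩
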